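/- A rectangular diagram is a link diagram in the plane composed of $n$ vertical and $n$ horizontal edges, no two vertical edges collinear and no two horizontal edges collinear, in which the vertical edge passes over the horizontal edge at each crossing; diagrams are considered up to order-preserving changes of the abscissae and of the heights. The following moves are described for horizontal edges; the vertical versions are defined in the same way with the roles of the two directions exchanged. Merge: if two horizontal edges are connected by a single vertical edge, and either they lie at adjacent heights (interior merge) or they are the top and the bottom horizontal edge (exterior merge), then the three edges are amalgamated into a single horizontal edge, which in the exterior case is placed either at the top or at the bottom height. Exchange: if two horizontal edges are not interleaved (the abscissae of their endpoints do not alternate), and either they lie at adjacent heights (interior exchange) or they are the top and the bottom horizontal edge (exterior exchange), then their heights are exchanged. Theorem. There is a rectangular diagram $D$ of the trivial knot, with $8$ vertical and $8$ horizontal edges, such that no merge move (interior or exterior, horizontal or vertical) and no interior exchange move (horizontal or vertical) applies to $D$. The diagram $D$ can be deformed into the trivial rectangular diagram with two vertical and two horizontal edges by a finite sequence of exchange moves and merge moves, and every such sequence begins with, and hence contains, an exterior exchange move. -/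

import Mathlib

/-! ### Polygonal knots in 3-space and their equivalence -/

namespace PolyKnot

/-- Points of 3-space; only the affine structure is used. -/
abbrev Pt : Type := Fin 3 → ℝ

/-- The edges `(v₁,v₂), …, (vₖ₋₁,vₖ), (vₖ,v₁)` of the closed polygon with vertices `v₁, …, vₖ`. -/
def edges (l : List Pt) : List (Pt × Pt) := l.zip (l.rotate 1)

/-- The point set of the closed polygon with the given vertices. -/
def carrier (l : List Pt) : Set Pt := {p | ∃ e ∈ edges l, p ∈ segment ℝ e.1 e.2}

/-- The edge with its first endpoint and without its second one. -/
def halfOpenEdge (e : Pt × Pt) : Set Pt := insert e.1 (openSegment ℝ e.1 e.2)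

/-- The closed polygon is a simple closed curve: no edge is degenerate, and the half-open edges
are pairwise disjoint (so that it is traversed without self-intersection). -/
def IsSimple (l : List Pt) : Prop :=
  3 ≤ l.length ∧ (∀ e ∈ edges l, e.1 ≠ e.2) ∧
    (edges l).Pairwise fun e f => Disjoint (halfOpenEdge e) (halfOpenEdge f)

/-- `J` arises from the polygonal knot `K` by an elementary deformation (a triangle move): an edge
`ab` of `K` is replaced by `ap ∪ pb`, where `a, p, b` are not collinear and the solid triangle `apb`
meets `K` in the edge `ab` only. (Then `J` is a polygonal knot too. As `K` and `J` are point sets,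
the choice of the first vertex, the direction and extra vertices on edges play no role.) -/
def ElementaryDeformation (K J : Set Pt) : Prop :=
  ∃ (a b p : Pt) (m : List Pt),
    IsSimple (a :: b :: m) ∧ K = carrier (a :: b :: m) ∧ J = carrier (a :: p :: b :: m) ∧
    ¬ Collinear ℝ ({a, p, b} : Set Pt) ∧
    convexHull ℝ ({a, p, b} : Set Pt) ∩ K = segment ℝ a b

/-- Combinatorial equivalence of polygonal knots: a finite sequence of elementary deformations
and inverses of such. -/
def Equivalent : Set Pt → Set Pt → Prop := Relation.EqvGen ElementaryDeformation

/-- The trivial knot type: knots equivalent to the boundary of a triangle. -/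
def IsTrivialKnot (K : Set Pt) : Prop :=
  ∃ a b c : Pt, ¬ Collinear ℝ ({a, b, c} : Set Pt) ∧ Equivalent K (carrier [a, b, c])

end PolyKnot

/-! ### Rectangular diagrams -/

/-- A rectangular diagram of a link with `n` vertical and `n` horizontal edges, normalized so that
the edges lie on the lines `x = 0, …, n - 1` and `y = 0, …, n - 1`. It is given by its corners: each
of these lines carries exactly two of them, the endpoints of the edge on this line. At a crossing
the vertical edge passes over the horizontal one. -/
structure RectDiagram (n : ℕ) where
  corners : Finset (Fin n × Fin n)
  col_card : ∀ x : Fin n, (corners.filter fun p => p.1 = x).card = 2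
  row_card : ∀ y : Fin n, (corners.filter fun p => p.2 = y).card = 2

namespace RectDiagram

/-- The point of 3-space over the grid point `p` at level `z`. -/
def lift {n : ℕ} (p : Fin n × Fin n) (z : ℝ) : PolyKnot.Pt := ![((p.1 : ℕ) : ℝ), ((p.2 : ℕ) : ℝ), z]

/-- The link in 3-space represented by the diagram (projected along the third coordinate, seen from
above): the horizontal edges are placed at level `0`, the vertical edges at level `1`, and they are
joined by a segment over each corner. -/
def link {n : ℕ} (D : RectDiagram n) : Set PolyKnot.Pt :=
  {P | ∃ p ∈ D.corners, ∃ q ∈ D.corners, p.2 = q.2 ∧ P ∈ segment ℝ (lift p 0) (lift q 0)} ∪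
  {P | ∃ p ∈ D.corners, ∃ q ∈ D.corners, p.1 = q.1 ∧ P ∈ segment ℝ (lift p 1) (lift q 1)} ∪
  {P | ∃ p ∈ D.corners, P ∈ segment ℝ (lift p 0) (lift p 1)}

/-- The diagram represents the trivial knot. -/
def RepresentsTrivialKnot {n : ℕ} (D : RectDiagram n) : Prop := PolyKnot.IsTrivialKnot D.link

/-- The reflection in the line `x = y` of the arrangement of edges; it is used only to obtain the
vertical moves from the horizontal ones. -/
def transpose {n : ℕ} (D : RectDiagram n) : RectDiagram n where
  corners := D.corners.map (Equiv.prodComm (Fin n) (Fin n)).toEmbedding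
  col_card x := by
    rw [Finset.filter_map, Finset.card_map]
    exact D.row_card x
  row_card y := by
    rw [Finset.filter_map, Finset.card_map]
    exact D.col_card y

/-- Two lines of the grid at adjacent positions. -/
def Adjacent {n : ℕ} (r s : Fin n) : Prop := (r : ℕ) + 1 = s ∨ (s : ℕ) + 1 = r

/-- The first and the last line of the grid, in either order. -/
def Extreme {n : ℕ} (r s : Fin n) : Prop :=
  ((r : ℕ) = 0 ∧ (s : ℕ) + 1 = n) ∨ ((s : ℕ) = 0 ∧ (r : ℕ) + 1 = n)

/-- The endpoints of the horizontal edges at heights `r` and `s` alternate. -/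
def Interleaved {n : ℕ} (D : RectDiagram n) (r s : Fin n) : Prop :=
  ∃ a b c d : Fin n, (a, r) ∈ D.corners ∧ (b, r) ∈ D.corners ∧
    (c, s) ∈ D.corners ∧ (d, s) ∈ D.corners ∧
    ((a < c ∧ c < b ∧ b < d) ∨ (c < a ∧ a < d ∧ d < b))

/-- `E` arises from `D` by exchanging the heights of the non-interleaved horizontal edges at
heights `r` and `s`. -/
def HorizontalExchange {n : ℕ} (r s : Fin n) (D E : RectDiagram n) : Prop :=
  ¬ D.Interleaved r s ∧
    ∀ x y : Fin n, (x, y) ∈ E.corners ↔ (x, Equiv.swap r s y) ∈ D.corners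

/-- `E` arises from `D` by amalgamating the horizontal edges at heights `r` and `s` and the vertical
edge that connects them into a single horizontal edge at height `s`. Here `i` is the abscissa of the
vertical edge; the lines `x = i` and `y = r` become empty and are deleted from the grid. (Since `E`
is a rectangular diagram, the new edge has two distinct endpoints, that is, only one vertical edge
connects the two horizontal ones.) -/
def HorizontalMerge {n : ℕ} (r s : Fin (n + 1)) (D : RectDiagram (n + 1)) (E : RectDiagram n) :
    Prop :=
  ∃ i : Fin (n + 1), r ≠ s ∧ (i, r) ∈ D.corners ∧ (i, s) ∈ D.corners ∧
    ∀ x y : Fin n, (x, y) ∈ E.corners ↔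
      ((i.succAbove x, r.succAbove y) ∈ D.corners ∨
        (r.succAbove y = s ∧ (i.succAbove x, r) ∈ D.corners))

end RectDiagram

/-! ### Merge moves and exchange moves -/

/-- The kinds of moves (each of them comes in a horizontal and a vertical version). -/
inductive MoveKind : Type
  | interiorMerge
  | exteriorMerge
  | interiorExchange
  | exteriorExchange

open RectDiagram in
/-- `Move k D E`: the diagram `E` arises from `D` by a single move of kind `k`. -/
inductive Move : {m n : ℕ} → MoveKind → RectDiagram m → RectDiagram n → Prop
  | interiorHorizontalMerge {n : ℕ} {D : RectDiagram (n + 1)} {E : RectDiagram n}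
      (r s : Fin (n + 1)) (hrs : Adjacent r s) (h : HorizontalMerge r s D E) :
      Move .interiorMerge D E
  | interiorVerticalMerge {n : ℕ} {D : RectDiagram (n + 1)} {E : RectDiagram n}
      (r s : Fin (n + 1)) (hrs : Adjacent r s) (h : HorizontalMerge r s D.transpose E.transpose) :
      Move .interiorMerge D E
  | exteriorHorizontalMerge {n : ℕ} {D : RectDiagram (n + 1)} {E : RectDiagram n}
      (r s : Fin (n + 1)) (hrs : Extreme r s) (h : HorizontalMerge r s D E) :
      Move .exteriorMerge D E
  | exteriorVerticalMerge {n : ℕ} {D : RectDiagram (n + 1)} {E : RectDiagram n}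
      (r s : Fin (n + 1)) (hrs : Extreme r s) (h : HorizontalMerge r s D.transpose E.transpose) :
      Move .exteriorMerge D E
  | interiorHorizontalExchange {n : ℕ} {D E : RectDiagram n}
      (r s : Fin n) (hrs : Adjacent r s) (h : HorizontalExchange r s D E) :
      Move .interiorExchange D E
  | interiorVerticalExchange {n : ℕ} {D E : RectDiagram n}
      (r s : Fin n) (hrs : Adjacent r s) (h : HorizontalExchange r s D.transpose E.transpose) :
      Move .interiorExchange D E
  | exteriorHorizontalExchange {n : ℕ} {D E : RectDiagram n}
      (r s : Fin n) (hrs : Extreme r s) (h : HorizontalExchange r s D E) :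
      Move .exteriorExchange D E
  | exteriorVerticalExchange {n : ℕ} {D E : RectDiagram n}
      (r s : Fin n) (hrs : Extreme r s) (h : HorizontalExchange r s D.transpose E.transpose) :
      Move .exteriorExchange D E

/-- `MoveSeq ks D E`: a sequence of exchange and merge moves, of the kinds listed in `ks` in this
order, deforms `D` into `E`. -/
inductive MoveSeq : {m n : ℕ} → List MoveKind → RectDiagram m → RectDiagram n → Prop
  | nil {n : ℕ} (D : RectDiagram n) : MoveSeq [] D D
  | cons {l m n : ℕ} {k : MoveKind} {ks : List MoveKind}
      {D : RectDiagram l} {E : RectDiagram m} {F : RectDiagram n}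
      (hk : Move k D E) (hks : MoveSeq ks E F) : MoveSeq (k :: ks) D F

/-! The witness is the explicit diagram `hardUnknot`. In it any two neighbouring parallel edges are
interleaved, which blocks interior exchanges, and no two parallel edges that are neighbouring or
extreme share a perpendicular edge, which blocks all merges. A move on it is therefore an exterior
exchange (`eq_exteriorExchange_of_move`). A sequence ending in a diagram with two vertical edges
cannot be empty, so it starts with such a move (`exists_cons_of_moveSeq`). Conversely, one exterior
exchange of nested edges makes a merge possible, and an explicit sequence leads on to `unknotTwo`.

Triviality of the knot is proved in 3-space, independently of the moves. The link is a closed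
polygon with 32 lattice vertices (`link_eq_carrier`), and a list of triangle moves shrinks it to a
triangle (`isTrivialKnot_of_unknots`). Each triangle move is certified by integer linear forms that
separate the triangle from the remaining edges, so that everything reduces to finite integer
arithmetic. Simplicity is checked only for the initial polygon; `IsSimple.remove` and
`IsSimple.insert` carry it through the moves. -/

namespace PolyKnot

/-! ### Elementary deformations and simplicity -/

theorem edges_cons_cons (a b : Pt) (m : List Pt) :
    edges (a :: b :: m) = (a, b) :: (b :: m).zip (m ++ [a]) := by
  simp [edges]

theorem edges_cons_cons_cons (a p b : Pt) (m : List Pt) :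
    edges (a :: p :: b :: m) = (a, p) :: (p, b) :: (b :: m).zip (m ++ [a]) := by
  simp [edges]

theorem edges_rotate (l : List Pt) (k : ℕ) : edges (l.rotate k) = (edges l).rotate k := by
  unfold edges
  rw [List.rotate_rotate, Nat.add_comm, ← List.rotate_rotate]
  exact (List.zipWith_rotate_distrib Prod.mk l (l.rotate 1) k (by simp)).symm

theorem carrier_rotate (l : List Pt) (k : ℕ) : carrier (l.rotate k) = carrier l := by
  simp [carrier, edges_rotate]

theorem IsSimple.rotate {l : List Pt} (h : IsSimple l) (k : ℕ) : IsSimple (l.rotate k) := by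
  obtain ⟨h₁, h₂, h₃⟩ := h
  refine ⟨by simpa using h₁, ?_, ?_⟩
  · simpa [edges_rotate] using h₂
  · rw [edges_rotate]
    exact ((List.rotate_perm _ k).pairwise_iff fun h => h.symm).2 h₃

/-- The solid triangle `apb` meets the segment `e` in `a` and `b` at most. -/
def MeetsAtEndsOnly (a p b : Pt) (e : Pt × Pt) : Prop :=
  ∀ q ∈ convexHull ℝ ({a, p, b} : Set Pt), q ∈ segment ℝ e.1 e.2 → q = a ∨ q = b

theorem halfOpenEdge_subset_segment (e : Pt × Pt) : halfOpenEdge e ⊆ segment ℝ e.1 e.2 :=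
  Set.insert_subset (left_mem_segment ℝ _ _) (openSegment_subset_segment ℝ _ _)

theorem right_notMem_halfOpenEdge {a b : Pt} (h : a ≠ b) : b ∉ halfOpenEdge (a, b) := by
  rintro (rfl | hb)
  · exact h rfl
  · exact h (right_mem_openSegment_iff.1 hb)

theorem collinear_of_mem_segment {a b q : Pt} (h : q ∈ segment ℝ a b) :
    Collinear ℝ ({a, q, b} : Set Pt) :=
  (mem_segment_iff_wbtw.1 h).collinear

theorem segment_subset_triangle {a p b x y : Pt} (hx : x ∈ ({a, p, b} : Set Pt))
    (hy : y ∈ ({a, p, b} : Set Pt)) : segment ℝ x y ⊆ convexHull ℝ ({a, p, b} : Set Pt) :=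
  segment_subset_convexHull hx hy

/-- The edge `ab` lies in the triangle, and every other edge contributes at most `a` and `b` to the
intersection, which are already on `ab`. -/
theorem elementaryDeformation_of_meetsAtEndsOnly {a p b : Pt} {m : List Pt}
    (hs : IsSimple (a :: b :: m)) (hc : ¬ Collinear ℝ ({a, p, b} : Set Pt))
    (hm : ∀ e ∈ (b :: m).zip (m ++ [a]), MeetsAtEndsOnly a p b e) :
    ElementaryDeformation (carrier (a :: b :: m)) (carrier (a :: p :: b :: m)) := by
  refine ⟨a, b, p, m, hs, rfl, rfl, hc, Set.Subset.antisymm ?_ ?_⟩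
  · rintro q ⟨hq, e, he, hqe⟩
    rw [edges_cons_cons, List.mem_cons] at he
    rcases he with rfl | he
    · exact hqe
    · rcases hm e he q hq hqe with rfl | rfl
      · exact left_mem_segment ℝ _ _
      · exact right_mem_segment ℝ _ _
  · intro q hq
    refine ⟨segment_subset_triangle (by simp) (by simp) hq, (a, b), ?_, hq⟩
    simp [edges_cons_cons]

section
variable {a p b : Pt} {m : List Pt}

theorem ne_of_not_collinear (hc : ¬ Collinear ℝ ({a, p, b} : Set Pt)) :
    a ≠ p ∧ p ≠ b ∧ a ≠ b := by
  refine ⟨?_, ?_, ?_⟩ <;> rintro rfl <;> apply hc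
  · simpa using collinear_pair ℝ a b
  · simpa using collinear_pair ℝ a p
  · rw [Set.insert_comm]; simpa using collinear_pair ℝ p a

/-- Only `ab` is new. It can meet another edge only in `a`, which the old half-open edge `ap`
already keeps off that edge, or in `b`, which the half-open `ab` omits. -/
theorem IsSimple.remove (hs : IsSimple (a :: p :: b :: m)) (hne : m ≠ [])
    (hc : ¬ Collinear ℝ ({a, p, b} : Set Pt))
    (hm : ∀ e ∈ (b :: m).zip (m ++ [a]), MeetsAtEndsOnly a p b e) : IsSimple (a :: b :: m) := by
  obtain ⟨-, h₂, h₃⟩ := hs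
  obtain ⟨-, -, hab⟩ := ne_of_not_collinear hc
  rw [edges_cons_cons_cons] at h₂ h₃
  simp only [List.pairwise_cons, List.mem_cons] at h₂ h₃
  refine ⟨?_, ?_, ?_⟩
  · have := List.length_pos_iff.2 hne
    simp only [List.length_cons]; omega
  · rw [edges_cons_cons]
    rintro e he
    rcases List.mem_cons.1 he with rfl | he
    · exact hab
    · exact h₂ e (.inr (.inr he))
  · rw [edges_cons_cons, List.pairwise_cons]
    refine ⟨fun e he => Set.disjoint_left.2 fun q hq hqe => ?_, h₃.2.2⟩
    rcases hm e he q (segment_subset_triangle (by simp) (by simp)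
      (halfOpenEdge_subset_segment _ hq)) (halfOpenEdge_subset_segment _ hqe) with rfl | rfl
    · exact Set.disjoint_left.1 (h₃.1 e (.inr he)) (Set.mem_insert _ _) hqe
    · exact right_notMem_halfOpenEdge hab hq

/-- The new edges lie in the triangle, so they can meet an old one only in `a` or `b`. These cases
are excluded by the half-open convention, by simplicity at `a`, or because `b` on `ap` or `a` on
`pb` would make the triangle degenerate. -/
theorem IsSimple.insert (hs : IsSimple (a :: b :: m))
    (hc : ¬ Collinear ℝ ({a, p, b} : Set Pt))
    (hm : ∀ e ∈ (b :: m).zip (m ++ [a]), MeetsAtEndsOnly a p b e) :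
    IsSimple (a :: p :: b :: m) := by
  obtain ⟨h₁, h₂, h₃⟩ := hs
  obtain ⟨hap, hpb, hab⟩ := ne_of_not_collinear hc
  rw [edges_cons_cons] at h₂ h₃
  simp only [List.pairwise_cons, List.mem_cons] at h₂ h₃
  have hapb : ∀ q, q ∈ segment ℝ a p → q ∈ halfOpenEdge (p, b) → q = p := by
    rintro q hq (rfl | hq')
    · rfl
    -- A second common point `q` would put both `a` and `b` on the line through `p` and `q`.
    · by_contra hqp
      apply hc
      have hqb := mem_segment_iff_wbtw.1 (openSegment_subset_segment ℝ _ _ hq')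
      have hqa := mem_segment_iff_wbtw.1 hq
      have h1 : a ∈ line[ℝ, p, q] := hqa.symm.right_mem_affineSpan_of_left_ne (Ne.symm hqp)
      have h2 : b ∈ line[ℝ, p, q] := hqb.right_mem_affineSpan_of_left_ne (Ne.symm hqp)
      exact collinear_triple_of_mem_affineSpan_pair h1 (left_mem_affineSpan_pair ℝ _ _) h2
  refine ⟨by simp only [List.length_cons] at h₁ ⊢; omega, ?_, ?_⟩
  · rw [edges_cons_cons_cons]
    rintro e he
    simp only [List.mem_cons] at he
    rcases he with rfl | rfl | he
    · exact hap
    · exact hpb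
    · exact h₂ e (.inr he)
  · rw [edges_cons_cons_cons, List.pairwise_cons, List.pairwise_cons]
    refine ⟨fun e he => Set.disjoint_left.2 fun q hq hqe => ?_,
      fun e he => Set.disjoint_left.2 fun q hq hqe => ?_, h₃.2⟩
    · rcases List.mem_cons.1 he with rfl | he
      · have := hapb q (halfOpenEdge_subset_segment _ hq) hqe
        exact right_notMem_halfOpenEdge hap (this ▸ hq)
      · rcases hm e he q (segment_subset_triangle (by simp) (by simp)
          (halfOpenEdge_subset_segment _ hq)) (halfOpenEdge_subset_segment _ hqe) with rfl | rfl
        · exact Set.disjoint_left.1 (h₃.1 e he) (Set.mem_insert _ _) hqe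
        · apply hc
          rw [Set.pair_comm]
          exact collinear_of_mem_segment (halfOpenEdge_subset_segment _ hq)
    · rcases hm e he q (segment_subset_triangle (by simp) (by simp)
        (halfOpenEdge_subset_segment _ hq)) (halfOpenEdge_subset_segment _ hqe) with rfl | rfl
      · apply hc
        rw [Set.insert_comm]
        exact collinear_of_mem_segment (halfOpenEdge_subset_segment _ hq)
      · exact right_notMem_halfOpenEdge hpb hq

end

/-! ### Polygons with integral vertices -/

/-- Points with integral coordinates, also used as integral covectors. -/
abbrev LatticePt : Type := ℤ × ℤ × ℤ

namespace LatticePt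

/-- A lattice point as a point of 3-space. -/
def toPt (a : LatticePt) : Pt := ![(a.1 : ℝ), (a.2.1 : ℝ), (a.2.2 : ℝ)]

/-- The standard inner product. -/
def dot (n a : LatticePt) : ℤ := n.1 * a.1 + n.2.1 * a.2.1 + n.2.2 * a.2.2

/-- The cross product. -/
def cross (a b : LatticePt) : LatticePt :=
  (a.2.1 * b.2.2 - a.2.2 * b.2.1, a.2.2 * b.1 - a.1 * b.2.2, a.1 * b.2.1 - a.2.1 * b.1)

/-- The linear form on 3-space with the given integral coefficients. -/
noncomputable def form (n : LatticePt) : Pt →ₗ[ℝ] ℝ :=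
  (n.1 : ℝ) • LinearMap.proj 0 + (n.2.1 : ℝ) • LinearMap.proj 1 + (n.2.2 : ℝ) • LinearMap.proj 2

theorem form_toPt (n a : LatticePt) : form n (toPt a) = (dot n a : ℤ) := by
  simp [form, toPt, dot]

theorem not_collinear_of_cross_ne_zero {a p b : LatticePt}
    (h : cross (p - a) (b - a) ≠ 0) : ¬ Collinear ℝ ({toPt a, toPt p, toPt b} : Set Pt) := by
  intro hc
  obtain ⟨v, hv⟩ := (collinear_iff_of_mem (p₀ := toPt a) (by simp)).1 hc
  obtain ⟨r, hr⟩ := hv (toPt p) (by simp)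
  obtain ⟨s, hs⟩ := hv (toPt b) (by simp)
  apply h
  have r0 := congrFun hr 0
  have r1 := congrFun hr 1
  have r2 := congrFun hr 2
  have s0 := congrFun hs 0
  have s1 := congrFun hs 1
  have s2 := congrFun hs 2
  simp [toPt] at r0 r1 r2 s0 s1 s2
  have e : ∀ x y z w : ℤ, ((x * y - z * w : ℤ) : ℝ) = 0 → x * y - z * w = 0 :=
    fun _ _ _ _ h => by exact_mod_cast h
  simp only [cross, Prod.mk_eq_zero, Prod.fst_sub, Prod.snd_sub]
  refine ⟨e _ _ _ _ ?_, e _ _ _ _ ?_, e _ _ _ _ ?_⟩ <;> push_cast <;>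
    simp only [r0, r1, r2, s0, s1, s2] <;> ring

/-- The form `n` weakly separates the triangle `apb` from the segment `cd`, and the separating
plane contains no points of the segment other than `a` or `b`. -/
def Separates (n a p b c d : LatticePt) : Bool :=
  let t := max (dot n a) (max (dot n p) (dot n b))
  let s := dot n c
  let u := dot n d
  (t < s && (t < u || (t == u && (d == a || d == b)))) || (t < u && t == s && (c == a || c == b))

theorem meetsAtEndsOnly_of_separates {n a p b c d : LatticePt} (h : Separates n a p b c d) :
    MeetsAtEndsOnly (toPt a) (toPt p) (toPt b) (toPt c, toPt d) := by
  intro q hq hqe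
  simp only [Separates, Bool.or_eq_true, Bool.and_eq_true, decide_eq_true_eq, beq_iff_eq] at h
  obtain ⟨t, ht⟩ : ∃ t, t = max (dot n a) (max (dot n p) (dot n b)) := ⟨_, rfl⟩
  rw [← ht] at h
  have hle : form n q ≤ t := by
    have hsub : ({toPt a, toPt p, toPt b} : Set Pt) ⊆ {x | form n x ≤ t} := by
      rintro x (rfl | rfl | rfl) <;> simp [form_toPt, ht]
    exact convexHull_min hsub (convex_halfSpace_le (form n).isLinear _) hq
  obtain ⟨x, y, hx, hy, hxy, rfl⟩ := hqe
  simp only [map_add, map_smul, form_toPt, smul_eq_mul] at hle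
  obtain rfl : y = 1 - x := by linarith
  rcases h with ⟨hs, hu⟩ | ⟨⟨hu, hs⟩, hca⟩
  · have hs' : (t : ℝ) < dot n c := by exact_mod_cast hs
    have hu' : (t : ℝ) ≤ dot n d := by
      rcases hu with hu | hu
      · exact_mod_cast hu.le
      · exact_mod_cast hu.1.le
    -- The form exceeds `t` at `c` and is at least `t` at `d`, so any weight on `c` would push the
    -- point out of the half-space containing the triangle.
    have hx0 : x = 0 := by
      by_contra hne
      have : 0 < x := lt_of_le_of_ne hx (Ne.symm hne)
      nlinarith
    subst hx0
    rcases hu with hu | ⟨-, rfl | rfl⟩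
    · have hu'' : (t : ℝ) < dot n d := by exact_mod_cast hu
      linarith
    · simp
    · simp
  · have hu' : (t : ℝ) < dot n d := by exact_mod_cast hu
    have hs' : (t : ℝ) = dot n c := by exact_mod_cast hs
    have hx1 : x = 1 := by
      by_contra hne
      have : 0 < 1 - x := lt_of_le_of_ne hy fun h => hne (by linarith)
      nlinarith
    subst hx1
    rcases hca with rfl | rfl <;> simp

/-- Normals of planes among which a plane separating the triangle `apb` from the segment `cd`
is sought. -/
def normals (a p b c d : LatticePt) : List LatticePt :=
  let w := cross (p - a) (b - a)
  let u := d - c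
  w :: [p - a, b - p, a - b].flatMap fun e => [cross e u, cross e w, cross (cross e u) u]

/-- A sufficient test for the triangle `apb` to meet the segment `cd` in `a` and `b` at most. -/
def clearOf (a p b : LatticePt) (e : LatticePt × LatticePt) : Bool :=
  (normals a p b e.1 e.2).any fun n =>
    Separates n a p b e.1 e.2 || Separates (-n) a p b e.1 e.2

/-- Soundness does not depend on the choice of candidates, as any separating normal will do. Those
tried are the normal `w` of the triangle and, for each side `e` with `u` the direction of the
segment, the normals orthogonal to `e` and `u`, to `e` and `w`, and the component of `e` orthogonal
to `u` up to a factor. -/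
theorem meetsAtEndsOnly_of_clearOf {a p b : LatticePt} {e : LatticePt × LatticePt}
    (h : clearOf a p b e) :
    MeetsAtEndsOnly (toPt a) (toPt p) (toPt b) (Prod.map toPt toPt e) := by
  obtain ⟨n, -, hn⟩ := List.any_eq_true.1 h
  rcases Bool.or_eq_true_iff.1 hn with hn | hn <;> exact meetsAtEndsOnly_of_separates hn

/-- A test for `ap ∪ pb` and `ab` to be related by an elementary deformation of the closed polygon
with vertices `a, b, m`. -/
def triangleClear (a p b : LatticePt) (m : List LatticePt) : Bool :=
  cross (p - a) (b - a) != 0 && ((b :: m).zip (m ++ [a])).all (clearOf a p b)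

theorem not_collinear_of_triangleClear {a p b : LatticePt} {m : List LatticePt}
    (h : triangleClear a p b m) : ¬ Collinear ℝ ({toPt a, toPt p, toPt b} : Set Pt) := by
  simp only [triangleClear, Bool.and_eq_true, bne_iff_ne] at h
  exact not_collinear_of_cross_ne_zero h.1

theorem meetsAtEndsOnly_of_triangleClear {a p b : LatticePt} {m : List LatticePt}
    (h : triangleClear a p b m) :
    ∀ e ∈ (toPt b :: m.map toPt).zip (m.map toPt ++ [toPt a]),
      MeetsAtEndsOnly (toPt a) (toPt p) (toPt b) e := by
  simp only [triangleClear, Bool.and_eq_true, List.all_eq_true] at h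
  have hz : (toPt b :: m.map toPt).zip (m.map toPt ++ [toPt a]) =
      ((b :: m).zip (m ++ [a])).map (Prod.map toPt toPt) := by
    rw [← List.zip_map]; simp
  rw [hz]
  intro e he
  obtain ⟨e', he', rfl⟩ := List.mem_map.1 he
  exact meetsAtEndsOnly_of_clearOf (h.2 e' he')

/-- A test for a sequence of triangle moves to lead from the given closed polygon to a triangle.
At each step the list of vertices is first rotated by the given number; then either its second
vertex is removed, or the given vertex is inserted at the second place. -/
def unknots : List LatticePt → List (ℕ × Option LatticePt) → Bool
  | l, [] => match l with
    | [a, b, c] => cross (b - a) (c - a) != 0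
    | _ => false
  | l, (k, none) :: steps => match l.rotate k with
    | a :: p :: b :: m => !m.isEmpty && triangleClear a p b m && unknots (a :: b :: m) steps
    | _ => false
  | l, (k, some p) :: steps => match l.rotate k with
    | a :: b :: m => triangleClear a p b m && unknots (a :: p :: b :: m) steps
    | _ => false

theorem isTrivialKnot_of_unknots (steps : List (ℕ × Option LatticePt)) :
    ∀ l : List LatticePt, IsSimple (l.map toPt) → unknots l steps →
      IsTrivialKnot (carrier (l.map toPt)) := by
  induction steps with
  | nil =>
    intro l _ h
    unfold unknots at h
    split at h
    · exact ⟨_, _, _, not_collinear_of_cross_ne_zero (bne_iff_ne.1 h), .refl _⟩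
    · simp at h
  | cons step steps ih =>
    obtain ⟨k, _ | p⟩ := step <;> intro l hs h <;> unfold unknots at h <;> split at h
    · rename_i a p b m hl
      simp only [Bool.and_eq_true, Bool.not_eq_true', List.isEmpty_eq_false_iff] at h
      obtain ⟨⟨hne, ht⟩, hu⟩ := h
      have hr := hs.rotate k
      rw [← List.map_rotate, hl] at hr
      -- An elementary deformation starts from the polygon with fewer vertices. Removing a vertex is
      -- thus the inverse of one and needs simplicity of the shortened polygon.
      have hs' := hr.remove (by simpa using hne) (not_collinear_of_triangleClear ht)
        (meetsAtEndsOnly_of_triangleClear ht)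
      obtain ⟨x, y, z, hxyz, he⟩ := ih (a :: b :: m) hs' hu
      refine ⟨x, y, z, hxyz, .trans _ _ _ (.symm _ _ (.rel _ _ ?_)) he⟩
      rw [← carrier_rotate (l.map toPt) k, ← List.map_rotate, hl]
      exact elementaryDeformation_of_meetsAtEndsOnly hs' (not_collinear_of_triangleClear ht)
        (meetsAtEndsOnly_of_triangleClear ht)
    · simp at h
    · rename_i a b m hl
      simp only [Bool.and_eq_true] at h
      obtain ⟨ht, hu⟩ := h
      have hr := hs.rotate k
      rw [← List.map_rotate, hl] at hr
      obtain ⟨x, y, z, hxyz, he⟩ := ih (a :: p :: b :: m) (hr.insert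
        (not_collinear_of_triangleClear ht) (meetsAtEndsOnly_of_triangleClear ht)) hu
      refine ⟨x, y, z, hxyz, .trans _ _ _ (.rel _ _ ?_) he⟩
      rw [← carrier_rotate (l.map toPt) k, ← List.map_rotate, hl]
      exact elementaryDeformation_of_meetsAtEndsOnly hr (not_collinear_of_triangleClear ht)
        (meetsAtEndsOnly_of_triangleClear ht)
    · simp at h

/-- The form `n` is smaller on the half-open edge `e` than on the edge `f`. -/
def belowEdge (n : LatticePt) (e f : LatticePt × LatticePt) : Bool :=
  let t := min (dot n f.1) (dot n f.2)
  dot n e.1 < t && dot n e.2 ≤ t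

theorem disjoint_of_belowEdge {n : LatticePt} {e f : LatticePt × LatticePt}
    (h : belowEdge n e f) :
    Disjoint (halfOpenEdge (Prod.map toPt toPt e)) (halfOpenEdge (Prod.map toPt toPt f)) := by
  simp only [belowEdge, Bool.and_eq_true, decide_eq_true_eq] at h
  obtain ⟨t, ht⟩ : ∃ t, t = min (dot n f.1) (dot n f.2) := ⟨_, rfl⟩
  rw [← ht] at h
  have h1 : (dot n e.1 : ℝ) < t := by exact_mod_cast h.1
  have h2 : (dot n e.2 : ℝ) ≤ t := by exact_mod_cast h.2
  have hf : segment ℝ (toPt f.1) (toPt f.2) ⊆ {x | (t : ℝ) ≤ form n x} :=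
    (convex_halfSpace_ge (form n).isLinear _).segment_subset
      (by simp [form_toPt, ht]) (by simp [form_toPt, ht])
  refine Set.disjoint_left.2 fun q hq hqf => ?_
  have hge : (t : ℝ) ≤ form n q := hf (halfOpenEdge_subset_segment _ hqf)
  -- Every point of the half-open edge has positive weight on its first endpoint, where the form is
  -- strictly below `t`.
  rcases hq with rfl | ⟨x, y, hx, hy, hxy, rfl⟩
  · simp only [Prod.map_fst, form_toPt] at hge
    linarith
  · simp only [Prod.map_fst, Prod.map_snd, map_add, map_smul, form_toPt, smul_eq_mul] at hge
    obtain rfl : y = 1 - x := by linarith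
    nlinarith

/-- A coordinate separates the half-open edges `e` and `f`. -/
def apart (e f : LatticePt × LatticePt) : Bool :=
  [(1, 0, 0), (0, 1, 0), (0, 0, 1)].any fun n : LatticePt =>
    belowEdge n e f || belowEdge n f e || belowEdge (-n) e f || belowEdge (-n) f e

theorem disjoint_of_apart {e f : LatticePt × LatticePt} (h : apart e f) :
    Disjoint (halfOpenEdge (Prod.map toPt toPt e)) (halfOpenEdge (Prod.map toPt toPt f)) := by
  obtain ⟨n, -, hn⟩ := List.any_eq_true.1 h
  simp only [Bool.or_eq_true] at hn
  rcases hn with ((hn | hn) | hn) | hn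
  · exact disjoint_of_belowEdge hn
  · exact (disjoint_of_belowEdge hn).symm
  · exact disjoint_of_belowEdge hn
  · exact (disjoint_of_belowEdge hn).symm

theorem toPt_injective : Function.Injective toPt := by
  intro a b h
  have h0 := congrFun h 0
  have h1 := congrFun h 1
  have h2 := congrFun h 2
  simp [toPt] at h0 h1 h2
  exact Prod.ext h0 (Prod.ext h1 h2)

theorem edges_map_toPt (l : List LatticePt) :
    edges (l.map toPt) = (l.zip (l.rotate 1)).map (Prod.map toPt toPt) := by
  rw [edges, ← List.map_rotate, List.zip_map]

/-- Coordinate forms are enough for the intended polygon because its edges are parallel to the axes.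
Consecutive edges pass the test since the shared vertex is omitted from the first of them. -/
theorem isSimple_of_apart {l : List LatticePt} (h₁ : 3 ≤ l.length)
    (h₂ : ∀ e ∈ l.zip (l.rotate 1), e.1 ≠ e.2)
    (h₃ : (l.zip (l.rotate 1)).Pairwise fun e f => apart e f = true) :
    IsSimple (l.map toPt) := by
  refine ⟨by simpa using h₁, ?_, ?_⟩
  · rw [edges_map_toPt]
    intro e he
    obtain ⟨e', he', rfl⟩ := List.mem_map.1 he
    exact toPt_injective.ne (h₂ e' he')
  · rw [edges_map_toPt, List.pairwise_map]
    exact h₃.imp disjoint_of_apart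

end LatticePt

end PolyKnot

namespace RectDiagram

/-! ### The link of a rectangular diagram as a closed polygon -/

open PolyKnot PolyKnot.LatticePt

/-- The lattice point over the grid point `p` at level `z`. -/
def latticeLift {n : ℕ} (p : Fin n × Fin n) (z : ℤ) : LatticePt := ((p.1 : ℕ), (p.2 : ℕ), z)

theorem toPt_latticeLift_zero {n : ℕ} (p : Fin n × Fin n) :
    toPt (latticeLift p 0) = lift p 0 := by
  simp [toPt, latticeLift, lift]

theorem toPt_latticeLift_one {n : ℕ} (p : Fin n × Fin n) :
    toPt (latticeLift p 1) = lift p 1 := by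
  simp [toPt, latticeLift, lift]

/-- `ab` or `ba` is an edge of the closed polygon `l`. -/
def HasEdge (l : List LatticePt) (a b : LatticePt) : Prop :=
  (a, b) ∈ l.zip (l.rotate 1) ∨ (b, a) ∈ l.zip (l.rotate 1)

instance (l : List LatticePt) (a b : LatticePt) : Decidable (HasEdge l a b) :=
  inferInstanceAs (Decidable (_ ∨ _))

theorem segment_subset_carrier {l : List LatticePt} {a b : LatticePt} (h : HasEdge l a b) :
    segment ℝ (toPt a) (toPt b) ⊆ carrier (l.map toPt) := by
  intro q hq
  rcases h with h | h
  · exact ⟨_, edges_map_toPt l ▸ List.mem_map_of_mem h, hq⟩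
  · exact ⟨_, edges_map_toPt l ▸ List.mem_map_of_mem h, segment_symm ℝ (toPt a) (toPt b) ▸ hq⟩

theorem link_eq_carrier {n : ℕ} (D : RectDiagram n) (l : List LatticePt)
    (hor : ∀ p ∈ D.corners, ∀ q ∈ D.corners, p.2 = q.2 → p ≠ q →
      HasEdge l (latticeLift p 0) (latticeLift q 0))
    (vert : ∀ p ∈ D.corners, ∀ q ∈ D.corners, p.1 = q.1 → p ≠ q →
      HasEdge l (latticeLift p 1) (latticeLift q 1))
    (join : ∀ p ∈ D.corners, HasEdge l (latticeLift p 0) (latticeLift p 1))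
    (all : ∀ e ∈ l.zip (l.rotate 1),
      (∃ p ∈ D.corners, ∃ q ∈ D.corners, p.2 = q.2 ∧ e = (latticeLift p 0, latticeLift q 0)) ∨
      (∃ p ∈ D.corners, ∃ q ∈ D.corners, p.1 = q.1 ∧ e = (latticeLift p 1, latticeLift q 1)) ∨
      (∃ p ∈ D.corners, e = (latticeLift p 0, latticeLift p 1) ∨
        e = (latticeLift p 1, latticeLift p 0))) :
    D.link = carrier (l.map toPt) := by
  have hjoin : ∀ p ∈ D.corners, segment ℝ (lift p 0) (lift p 1) ⊆ carrier (l.map toPt) := by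
    intro p hp
    rw [← toPt_latticeLift_zero, ← toPt_latticeLift_one]
    exact segment_subset_carrier (join p hp)
  apply Set.Subset.antisymm
  · rintro P ((⟨p, hp, q, hq, hpq, hP⟩ | ⟨p, hp, q, hq, hpq, hP⟩) | ⟨p, hp, hP⟩)
    -- The definition of `link` allows `p = q`; the segment is then a single point, which lies on
    -- the joining segment over `p`.
    · by_cases h : p = q
      · subst h
        rw [segment_same] at hP
        exact hjoin p hp (hP ▸ left_mem_segment ℝ _ _)
      · rw [← toPt_latticeLift_zero, ← toPt_latticeLift_zero] at hP
        exact segment_subset_carrier (hor p hp q hq hpq h) hP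
    · by_cases h : p = q
      · subst h
        rw [segment_same] at hP
        exact hjoin p hp (hP ▸ right_mem_segment ℝ _ _)
      · rw [← toPt_latticeLift_one, ← toPt_latticeLift_one] at hP
        exact segment_subset_carrier (vert p hp q hq hpq h) hP
    · exact hjoin p hp hP
  · rintro P ⟨e, he, hP⟩
    rw [edges_map_toPt] at he
    obtain ⟨e', he', rfl⟩ := List.mem_map.1 he
    rcases all e' he' with ⟨p, hp, q, hq, hpq, rfl⟩ | ⟨p, hp, q, hq, hpq, rfl⟩ |
        ⟨p, hp, rfl | rfl⟩ <;>
      simp only [Prod.map_fst, Prod.map_snd, toPt_latticeLift_zero, toPt_latticeLift_one] at hP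
    · exact .inl (.inl ⟨p, hp, q, hq, hpq, hP⟩)
    · exact .inl (.inr ⟨p, hp, q, hq, hpq, hP⟩)
    · exact .inr ⟨p, hp, hP⟩
    · exact .inr ⟨p, hp, segment_symm ℝ (lift p 1) (lift p 0) ▸ hP⟩

/-! ### Obstructions to moves -/

instance {n : ℕ} (r s : Fin n) : Decidable (Adjacent r s) := inferInstanceAs (Decidable (_ ∨ _))

instance {n : ℕ} (r s : Fin n) : Decidable (Extreme r s) := inferInstanceAs (Decidable (_ ∨ _))

/-- Testing membership right after each quantifier lets evaluation discard most candidates early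
instead of running through all quadruples. -/
instance {n : ℕ} (D : RectDiagram n) (r s : Fin n) : Decidable (D.Interleaved r s) :=
  decidable_of_iff (∃ a, (a, r) ∈ D.corners ∧ ∃ b, (b, r) ∈ D.corners ∧
    ∃ c, (c, s) ∈ D.corners ∧ ∃ d, (d, s) ∈ D.corners ∧
      ((a < c ∧ c < b ∧ b < d) ∨ (c < a ∧ a < d ∧ d < b)))
    ⟨fun ⟨a, ha, b, hb, c, hc, d, hd, h⟩ => ⟨a, b, c, d, ha, hb, hc, hd, h⟩,
      fun ⟨a, b, c, d, ha, hb, hc, hd, h⟩ => ⟨a, ha, b, hb, c, hc, d, hd, h⟩⟩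

instance {n : ℕ} (r s : Fin n) (D E : RectDiagram n) : Decidable (HorizontalExchange r s D E) :=
  inferInstanceAs (Decidable (_ ∧ _))

/-- No horizontal merge move and no interior horizontal exchange move applies to `D`. -/
def HorizontallyRigid {n : ℕ} (D : RectDiagram n) : Prop :=
  (∀ r s, Adjacent r s → D.Interleaved r s) ∧
    ∀ r s, Adjacent r s ∨ Extreme r s → ∀ i, (i, r) ∈ D.corners → (i, s) ∉ D.corners

theorem HorizontallyRigid.not_merge {n : ℕ} {D : RectDiagram (n + 1)} {E : RectDiagram n}
    (h : D.HorizontallyRigid) {r s : Fin (n + 1)} (hrs : Adjacent r s ∨ Extreme r s) :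
    ¬ HorizontalMerge r s D E := by
  rintro ⟨i, -, hr, hs, -⟩
  exact h.2 r s hrs i hr hs

theorem HorizontallyRigid.not_exchange {n : ℕ} {D E : RectDiagram n}
    (h : D.HorizontallyRigid) {r s : Fin n} (hrs : Adjacent r s) :
    ¬ HorizontalExchange r s D E :=
  fun he => he.1 (h.1 r s hrs)

theorem eq_exteriorExchange_of_move {m n : ℕ} {k : MoveKind} {D : RectDiagram m}
    {E : RectDiagram n} (h : D.HorizontallyRigid) (ht : D.transpose.HorizontallyRigid)
    (hm : Move k D E) : k = .exteriorExchange := by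
  cases hm with
  | interiorHorizontalMerge r s hrs hm => exact absurd hm (h.not_merge (.inl hrs))
  | interiorVerticalMerge r s hrs hm => exact absurd hm (ht.not_merge (.inl hrs))
  | exteriorHorizontalMerge r s hrs hm => exact absurd hm (h.not_merge (.inr hrs))
  | exteriorVerticalMerge r s hrs hm => exact absurd hm (ht.not_merge (.inr hrs))
  | interiorHorizontalExchange r s hrs hm => exact absurd hm (h.not_exchange hrs)
  | interiorVerticalExchange r s hrs hm => exact absurd hm (ht.not_exchange hrs)
  | exteriorHorizontalExchange => rfl
  | exteriorVerticalExchange => rfl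

theorem exists_cons_of_moveSeq {m n : ℕ} (hmn : m ≠ n) {ks : List MoveKind} {D : RectDiagram m}
    {E : RectDiagram n} (h : D.HorizontallyRigid) (ht : D.transpose.HorizontallyRigid)
    (hs : MoveSeq ks D E) : ∃ ks' : List MoveKind, ks = .exteriorExchange :: ks' := by
  cases hs with
  | nil => exact absurd rfl hmn
  | cons hk _ => exact ⟨_, by rw [eq_exteriorExchange_of_move h ht hk]⟩

/-! ### The diagram and its simplification -/

/-- A diagram of the trivial knot that admits no merge moves and no interior exchange moves. -/
def hardUnknot : RectDiagram 8 where
  corners := {(3, 0), (7, 0), (1, 1), (5, 1), (0, 2), (2, 2), (1, 3), (4, 3), (0, 4), (3, 4),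
    (2, 5), (6, 5), (5, 6), (7, 6), (4, 7), (6, 7)}
  col_card := by decide +kernel
  row_card := by decide +kernel

/-- The diagram obtained from `hardUnknot` by an exterior horizontal exchange move. -/
def hardUnknotExchanged : RectDiagram 8 where
  corners := {(4, 0), (6, 0), (1, 1), (5, 1), (0, 2), (2, 2), (1, 3), (4, 3), (0, 4), (3, 4),
    (2, 5), (6, 5), (5, 6), (7, 6), (3, 7), (7, 7)}
  col_card := by decide +kernel
  row_card := by decide +kernel

/-- The diagram obtained from `hardUnknotExchanged` by an interior horizontal merge move. -/
def unknotSeven : RectDiagram 7 where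
  corners := {(4, 0), (6, 0), (1, 1), (5, 1), (0, 2), (2, 2), (1, 3), (4, 3), (0, 4), (3, 4),
    (2, 5), (6, 5), (3, 6), (5, 6)}
  col_card := by decide +kernel
  row_card := by decide +kernel

/-- The diagram obtained from `unknotSeven` by an interior horizontal exchange move. -/
def unknotSevenExchanged : RectDiagram 7 where
  corners := {(4, 0), (6, 0), (1, 1), (5, 1), (0, 2), (2, 2), (1, 3), (4, 3), (0, 4), (3, 4),
    (3, 5), (5, 5), (2, 6), (6, 6)}
  col_card := by decide +kernel
  row_card := by decide +kernel

/-- The diagram obtained from `unknotSevenExchanged` by an exterior horizontal merge move. -/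
def unknotSix : RectDiagram 6 where
  corners := {(1, 0), (5, 0), (0, 1), (2, 1), (1, 2), (4, 2), (0, 3), (3, 3), (3, 4), (5, 4),
    (2, 5), (4, 5)}
  col_card := by decide +kernel
  row_card := by decide +kernel

/-- The diagram obtained from `unknotSix` by an interior horizontal merge move. -/
def unknotFive : RectDiagram 5 where
  corners := {(1, 0), (4, 0), (0, 1), (2, 1), (1, 2), (3, 2), (0, 3), (4, 3), (2, 4), (3, 4)}
  col_card := by decide +kernel
  row_card := by decide +kernel

/-- The diagram obtained from `unknotFive` by an exterior vertical merge move. -/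
def unknotFour : RectDiagram 4 where
  corners := {(0, 0), (3, 0), (1, 1), (3, 1), (0, 2), (2, 2), (1, 3), (2, 3)}
  col_card := by decide +kernel
  row_card := by decide +kernel

/-- The diagram obtained from `unknotFour` by an interior horizontal merge move. -/
def unknotThree : RectDiagram 3 where
  corners := {(0, 0), (1, 0), (0, 1), (2, 1), (1, 2), (2, 2)}
  col_card := by decide +kernel
  row_card := by decide +kernel

/-- The diagram obtained from `unknotThree` by an interior horizontal merge move. -/
def unknotTwo : RectDiagram 2 where
  corners := {(0, 0), (1, 0), (0, 1), (1, 1)}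
  col_card := by decide +kernel
  row_card := by decide +kernel

theorem exists_moveSeq_hardUnknot :
    ∃ (T : RectDiagram 2) (ks : List MoveKind), MoveSeq ks hardUnknot T := by
  refine ⟨unknotTwo, [.exteriorExchange, .interiorMerge, .interiorExchange,
    .exteriorMerge, .interiorMerge, .exteriorMerge, .interiorMerge,
    .interiorMerge], ?_⟩
  -- The bottom edge spans abscissae 3 to 7 and the top one 4 to 6, so they are nested. After the
  -- exchange the wide edge is next to the edge at height 6, with which it shares the column 7. In
  -- each merge the witness is the shared line.
  refine .cons (E := hardUnknotExchanged)
    (.exteriorHorizontalExchange 7 0 (by decide +kernel) (by decide +kernel)) ?_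
  refine .cons (E := unknotSeven)
    (.interiorHorizontalMerge 6 7 (by decide +kernel) ⟨7, by decide +kernel⟩) ?_
  refine .cons (E := unknotSevenExchanged)
    (.interiorHorizontalExchange 5 6 (by decide +kernel) (by decide +kernel)) ?_
  refine .cons (E := unknotSix)
    (.exteriorHorizontalMerge 0 6 (by decide +kernel) ⟨6, by decide +kernel⟩) ?_
  refine .cons (E := unknotFive)
    (.interiorHorizontalMerge 3 4 (by decide +kernel) ⟨3, by decide +kernel⟩) ?_
  refine .cons (E := unknotFour)
    (.exteriorVerticalMerge 0 4 (by decide +kernel) ⟨3, by decide +kernel⟩) ?_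
  refine .cons (E := unknotThree)
    (.interiorHorizontalMerge 0 1 (by decide +kernel) ⟨3, by decide +kernel⟩) ?_
  refine .cons (E := unknotTwo)
    (.interiorHorizontalMerge 0 1 (by decide +kernel) ⟨0, by decide +kernel⟩) ?_
  exact .nil _

theorem hardUnknot_horizontallyRigid : hardUnknot.HorizontallyRigid := by
  unfold HorizontallyRigid
  decide +kernel

theorem hardUnknot_transpose_horizontallyRigid : hardUnknot.transpose.HorizontallyRigid := by
  unfold HorizontallyRigid
  decide +kernel

/-- The vertices of the link of `hardUnknot`, in cyclic order. -/
def hardUnknotPolygon : List LatticePt :=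
  [(3, 0, 1), (3, 0, 0), (7, 0, 0), (7, 0, 1), (7, 6, 1), (7, 6, 0), (5, 6, 0), (5, 6, 1),
    (5, 1, 1), (5, 1, 0), (1, 1, 0), (1, 1, 1), (1, 3, 1), (1, 3, 0), (4, 3, 0), (4, 3, 1),
    (4, 7, 1), (4, 7, 0), (6, 7, 0), (6, 7, 1), (6, 5, 1), (6, 5, 0), (2, 5, 0), (2, 5, 1),
    (2, 2, 1), (2, 2, 0), (0, 2, 0), (0, 2, 1), (0, 4, 1), (0, 4, 0), (3, 4, 0), (3, 4, 1)]

theorem link_hardUnknot : hardUnknot.link = carrier (hardUnknotPolygon.map toPt) :=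
  link_eq_carrier _ _ (by decide +kernel) (by decide +kernel) (by decide +kernel)
    (by decide +kernel)

theorem isSimple_hardUnknotPolygon : IsSimple (hardUnknotPolygon.map toPt) :=
  isSimple_of_apart (by decide +kernel) (by decide +kernel) (by decide +kernel)

/-- Triangle moves that lead from `hardUnknotPolygon` to a triangle. -/
def hardUnknotSteps : List (ℕ × Option LatticePt) :=
  [(1, none), (8, none), (17, none), (7, none), (19, none), (13, none), (8, none), (8, none),
    (11, none), (0, none), (6, none), (5, none), (15, none), (7, none), (7, some (7, 6, 3)),
    (18, none), (17, none), (16, none), (13, some (4, -1, -3)), (16, none), (15, none),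
    (12, none), (5, none), (0, none), (7, none), (10, none), (0, none), (8, none), (0, none),
    (6, none), (3, none), (4, none), (0, none)]

/-- There are 31 removals and two insertions, so that 32 vertices become three. The inserted
vertices lie at level 3, above the link, and at level -3, below it. -/
theorem unknots_hardUnknotPolygon : unknots hardUnknotPolygon hardUnknotSteps := by
  decide +kernel

theorem representsTrivialKnot_hardUnknot : hardUnknot.RepresentsTrivialKnot := by
  rw [RepresentsTrivialKnot, link_hardUnknot]
  exact isTrivialKnot_of_unknots _ _ isSimple_hardUnknotPolygon unknots_hardUnknotPolygon

end RectDiagram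

/-- There is a rectangular diagram of the trivial knot with 8 vertical edges on which no merge move
and no interior exchange move applies; it can be deformed by exchange and merge moves into the
trivial rectangular diagram (the one with two vertical and two horizontal edges), and every sequence
of such moves that does this begins with, and so contains, an exterior exchange move. -/
theorem mainTheorem4 :
    ∃ D : RectDiagram 8, D.RepresentsTrivialKnot ∧
      (∀ (n : ℕ) (E : RectDiagram n), ¬ Move .interiorMerge D E ∧ ¬ Move .exteriorMerge D E ∧
        ¬ Move .interiorExchange D E) ∧
      (∃ (T : RectDiagram 2) (ks : List MoveKind), MoveSeq ks D T) ∧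
      (∀ (T : RectDiagram 2) (ks : List MoveKind), MoveSeq ks D T →
        ∃ ks' : List MoveKind, ks = .exteriorExchange :: ks') := by
  have h := RectDiagram.hardUnknot_horizontallyRigid
  have ht := RectDiagram.hardUnknot_transpose_horizontallyRigid
  refine ⟨_, RectDiagram.representsTrivialKnot_hardUnknot, fun n E => ⟨fun hm => ?_, fun hm => ?_,
    fun hm => ?_⟩, RectDiagram.exists_moveSeq_hardUnknot, fun T ks hs =>
    RectDiagram.exists_cons_of_moveSeq (by decide) h ht hs⟩
  all_goals
    have := RectDiagram.eq_exteriorExchange_of_move h ht hm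
    contradiction
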